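/- Let $p\in(1,\infty)$. Let $\ell^p_A$ be the Banach space of analytic functions $f(z)=\sum_{k\ge0}a_kz^k$ on the open unit disk $\mathbb D$ with $\|f\|_p=(\sum_k|a_k|^p)^{1/p}<\infty$. A sequence $W\subset\mathbb D$ is a zero set for $\ell^p_A$ if some $f\in\ell^p_A\setminus\{0\}$ vanishes on $W$, points repeated in $W$ being counted as multiplicities (other zeros are allowed). A sequence $(w_k)_{k\ge1}\subset\mathbb D$ satisfies the Newman–Shapiro condition if there is $c\in(0,1)$ with $1-|w_{k+1}|<c\,(1-|w_k|)$ for all $k$. For $k\ge1$ put $N_k=2^{2^{k-1}-1}$. For radii $r_1,r_2,\dots\in(0,1)$ let $(\rho_n)_{n\ge1}$ be the list of the points $r_ke^{2\pi i l/N_k}$, $0\le l<N_k$, $k\ge1$, circle after circle (so $|\rho_n|=r_k$ for $N_1+\dots+N_{k-1}<n\le N_1+\dots+N_k$). Put $f_k(z)=\prod_{n\le N_1+\dots+N_k}(1-z/\rho_n)$ and $$F_k(z)=\prod_{j=1}^k\Big(1-\frac1{2^{j-1}}\sum_{i=0}^{2^{j-1}-1}\frac{z^{2^iN_j}}{r_j^{2^iN_j}}\Big).$$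 (1) For all radii $r_k\in(0,1)$ and every $k$, the polynomial $f_k$ divides $F_k$, and $$\|F_k\|_p^p\le\prod_{j=1}^k\Big(1+\frac1{2^{(j-1)(p-1)}r_j^{N_j^2p}}\Big).$$ If moreover $\sum_{k\ge1}\frac{1}{2^{(k-1)(p-1)}r_k^{N_k^2p}}<\infty$, then $(\rho_n)_{n\ge1}$ is a zero set for $\ell^p_A$. (2) For every $a>1$ there is a strictly increasing sequence of radii $r_k\in(0,1)$ such that, for all sufficiently large $k$, $$r_k=\Big(\frac{k(\log k)^a}{2^{(k-1)(p-1)}}\Big)^{1/(N_k^2p)},$$ and for every such sequence of radii: the sum in (1) is finite, so $(\rho_n)$ is a zero set for $\ell^p_A$; the points $\rho_n$ are distinct, $|\rho_n|$ is non-decreasing and $|\rho_n|\to1$; with $L_n=\log_2(1+\log_2n)$, for all sufficiently large $n$, $$\Big(\frac{L_n(\log L_n)^a}{(2(1+\log_2n))^{p-1}}\Big)^{4/(pn^2)}\le|\rho_n|\le\Big(\frac{(2+L_n)(\log(2+L_n))^a}{(\frac12(1+\log_2n))^{p-1}}\Big)^{1/(4pn^4)};$$ the convergence to the circle is slower than geometric,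 that is, $c^n/(1-|\rho_n|)\to0$ for every $c\in(0,1)$; and the set $\{\rho_n\}$ is not contained in a union of finitely many sequences that satisfy the Newman–Shapiro condition. -/

import Mathlib

open Filter Topology

noncomputable section

/-- The space `ℓ^p_A`, for real `p > 1`: sequences of Taylor coefficients in `ℓ^p`, with the
`ℓ^p` norm. -/
abbrev EllPA (p : ℝ) := lp (fun _ : ℕ => ℂ) (ENNReal.ofReal p)

/-- The analytic function `z ↦ ∑ aₖ zᵏ` on the unit disk given by an element of `ℓ^p_A`. -/
def EllPA.eval {p : ℝ} (a : EllPA p) (z : ℂ) : ℂ := ∑' k : ℕ, a k * z ^ k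

/-- `g` vanishes on the sequence `W`, counting repetitions as multiplicities: the first occurrence
of a point asks for `g w = 0`, the second one for `g' w = 0`, and so on. -/
def VanishesOn (g : ℂ → ℂ) (W : ℕ → ℂ) : Prop :=
  ∀ n, iteratedDeriv ((Finset.range n).filter fun i => W i = W n).card g (W n) = 0

/-- The space `𝓡_W` of the functions of `ℓ^p_A` that vanish on `W`. -/
def zeroSpace (p : ℝ) (W : ℕ → ℂ) : Set (EllPA p) := {f | VanishesOn (EllPA.eval f) W}

/-- A sequence in the open unit disk is a zero set for `ℓ^p_A` if some nonzero function of
`ℓ^p_A` vanishes on it (with multiplicities; further zeros are allowed). -/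
def IsZeroSet (p : ℝ) (W : ℕ → ℂ) : Prop :=
  (∀ n, ‖W n‖ < 1) ∧ ∃ f ∈ zeroSpace p W, f ≠ 0

/-- The Newman–Shapiro condition: `w` converges exponentially to the unit circle. -/
def NewmanShapiro (w : ℕ → ℂ) : Prop :=
  (∀ k, ‖w k‖ < 1) ∧ ∃ c : ℝ, 0 < c ∧ c < 1 ∧ ∀ k, 1 - ‖w (k + 1)‖ < c * (1 - ‖w k‖)

/-- The points of `W` lie on finitely many sequences that satisfy the Newman–Shapiro condition.
(A finite sequence with this condition extends to an infinite one.) -/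
def CoveredByNewmanShapiro (W : ℕ → ℂ) : Prop :=
  ∃ (m : ℕ) (v : Fin m → ℕ → ℂ),
    (∀ i, NewmanShapiro (v i)) ∧ Set.range W ⊆ ⋃ i, Set.range (v i)

/-- The number of points on circle number `j + 1`. Circles are indexed from `0` here, so with
`k = j + 1` this is `N_k = 2 ^ (2 ^ (k - 1) - 1)`. -/
def circleCard (j : ℕ) : ℕ := 2 ^ (2 ^ j - 1)

/-- The number of points on the first `k` circles. -/
def blockStart (k : ℕ) : ℕ := ∑ j ∈ Finset.range k, circleCard j

/-- The index `j` with `blockStart j ≤ n < blockStart (j + 1)`. (As `j ≤ blockStart j`, the search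
may stop at `n`.) -/
def blockIndex (n : ℕ) : ℕ := Nat.findGreatest (fun j => blockStart j ≤ n) n

/-- The points `r_j · exp (2 π i l / N_j)`, `0 ≤ l < N_j`, listed circle after circle. -/
def targetPoint (r : ℕ → ℝ) (n : ℕ) : ℂ :=
  (r (blockIndex n) : ℂ) *
    Complex.exp (2 * Real.pi * Complex.I *
      ((n - blockStart (blockIndex n) : ℕ) : ℂ) / (circleCard (blockIndex n) : ℂ))

open Polynomial in
/-- The polynomial, with constant term `1`, whose zeros are precisely the points on the first `k`
circles. -/
def targetPoly (r : ℕ → ℝ) (k : ℕ) : ℂ[X] :=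
  ∏ n ∈ Finset.range (blockStart k), (1 - C (1 / targetPoint r n) * X)

open Polynomial in
/-- The lacunary product: its factor number `j + 1` is
`1 - 2 ^ (-j) * ∑ (z / r_j) ^ m`, with `m = N_j, 2 N_j, 4 N_j, …, N_j ^ 2`. -/
def lacunaryPoly (r : ℕ → ℝ) (k : ℕ) : ℂ[X] :=
  ∏ j ∈ Finset.range k,
    (1 - C (1 / (2 : ℂ) ^ j) *
      ∑ i ∈ Finset.range (2 ^ j),
        C (1 / (r j : ℂ) ^ (circleCard j * 2 ^ i)) * X ^ (circleCard j * 2 ^ i))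

/-- The quantity `1 / (2 ^ ((k - 1) (p - 1)) * r_k ^ (N_k ^ 2 * p))`, with `k = j + 1`. -/
def weight (p : ℝ) (r : ℕ → ℝ) (j : ℕ) : ℝ :=
  1 / ((2 : ℝ) ^ ((j : ℝ) * (p - 1)) * r j ^ ((circleCard j : ℝ) ^ 2 * p))

/-- Strictly increasing radii in `(0, 1)` that are given, from some index on, by
`r_k = (k (log k) ^ a / 2 ^ ((k - 1) (p - 1))) ^ (1 / (N_k ^ 2 * p))`, with `k = j + 1`. -/
def IsSlowRadii (p a : ℝ) (r : ℕ → ℝ) : Prop :=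
  (∀ j, 0 < r j ∧ r j < 1) ∧ StrictMono r ∧
    ∀ᶠ j : ℕ in atTop,
      r j = (((j : ℝ) + 1) * Real.log ((j : ℝ) + 1) ^ a / (2 : ℝ) ^ ((j : ℝ) * (p - 1))) ^
        (1 / ((circleCard j : ℝ) ^ 2 * p))

/-- `log₂ (1 + log₂ x)`. -/
def loglog (x : ℝ) : ℝ := Real.logb 2 (1 + Real.logb 2 x)

end

/-! ### Lacunary products: coefficients, norms, zeros. -/

section

open Polynomial Finset

/-! Write `N_j` for `circleCard j`. With `u = (z / r_j) ^ N_j`, the product of `1 - z / ρ` over the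
points `ρ` of circle `j` is `1 - u`. It divides `1 - 2 ^ (-j) ∑ u ^ (2 ^ i)`, which vanishes at `u =
1`. Spreading the mass of one coefficient over `2 ^ j` coefficients gains `2 ^ (-j (p - 1))` in the
`p`-th power of the norm, because `p > 1`. The recursion `N_{j+1} = 2 N_j ^ 2` keeps the degree of
the product of the first `k` factors below `N_k`, while the next factor is a polynomial in `z ^
N_k`. So no two monomials collide, and the `p`-th powers of the norms multiply
(`sum_coeff_mul_expand`). If the weights are summable, the products, which are truncations of one
power series, have bounded norm; the series lies in `ℓ^p_A`, has constant term `1`, and inherits the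
zeros through locally uniform convergence. The slow radii turn the weights into `1 / (k (log k) ^
a)`. Their distance to `1` is at least a constant over `N_j ^ 2`, and `N_j` is at most quadratic in
the position in the list, so convergence is no faster than polynomial. A Newman–Shapiro sequence
meets each circle at most once, whereas the circles carry unboundedly many points. -/

theorem circleCard_pos (j : ℕ) : 0 < circleCard j := by
  unfold circleCard; positivity

theorem circleCard_zero : circleCard 0 = 1 := rfl

theorem circleCard_succ (j : ℕ) : circleCard (j + 1) = 2 * circleCard j ^ 2 := by
  unfold circleCard
  rw [← pow_mul, ← pow_succ']
  congr 1
  have := Nat.one_le_two_pow (n := j)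
  rw [pow_succ]
  omega

theorem two_mul_circleCard (j : ℕ) : 2 * circleCard j = 2 ^ 2 ^ j := by
  unfold circleCard
  rw [← pow_succ']
  congr 1
  have := Nat.one_le_two_pow (n := j)
  omega

theorem circleCard_lt_succ (j : ℕ) : circleCard j < circleCard (j + 1) := by
  rw [circleCard_succ]
  nlinarith [circleCard_pos j]

theorem strictMono_circleCard : StrictMono circleCard := strictMono_nat_of_lt_succ circleCard_lt_succ

theorem lt_circleCard (j : ℕ) : j < circleCard j := by
  induction j with
  | zero => exact circleCard_pos 0
  | succ j ih => exact lt_of_le_of_lt ih (circleCard_lt_succ j)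

/-- Uniqueness of division by `N`: as `P` has degree below `N`, only one pair of monomials
contributes to the exponent `N * m + s`. -/
theorem coeff_mul_expand {R : Type*} [CommRing R] {N : ℕ} (hN : 0 < N) {P : R[X]}
    (hP : P.degree < N) (Q : R[X]) {s : ℕ} (hs : s < N) (m : ℕ) :
    (P * expand R N Q).coeff (N * m + s) = P.coeff s * Q.coeff m := by
  induction Q using Polynomial.induction_on' with
  | add f g hf hg => simp only [map_add, mul_add, coeff_add, hf, hg]
  | monomial d c =>
    rw [expand_monomial, ← C_mul_X_pow_eq_monomial, ← C_mul_X_pow_eq_monomial, mul_left_comm,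
      coeff_C_mul, coeff_C_mul, coeff_X_pow, coeff_mul_X_pow']
    rcases lt_trichotomy m d with h | rfl | h
    · have : N * (m + 1) ≤ N * d := Nat.mul_le_mul_left N h
      rw [if_neg (by rw [mul_comm d N]; rw [mul_add] at this; omega), if_neg h.ne]
      simp
    · rw [if_pos (by rw [mul_comm]; omega), if_pos rfl, mul_comm m N, Nat.add_sub_cancel_left]
      ring
    · have : N * (d + 1) ≤ N * m := Nat.mul_le_mul_left N h
      rw [mul_add] at this
      rw [if_neg h.ne', mul_comm d N, if_pos (by omega), coeff_eq_zero_of_degree_lt]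
      · simp
      · exact hP.trans_le (by exact_mod_cast (by omega))

theorem sum_coeff_mul_expand {N : ℕ} (hN : 0 < N) {P : ℂ[X]} (hP : P.degree < N) (Q : ℂ[X])
    (p : ℝ) (M : ℕ) :
    ∑ n ∈ range (N * M), ‖(P * expand ℂ N Q).coeff n‖ ^ p =
      (∑ n ∈ range N, ‖P.coeff n‖ ^ p) * ∑ m ∈ range M, ‖Q.coeff m‖ ^ p := by
  induction M with
  | zero => simp
  | succ M ih =>
    rw [mul_add, mul_one, Finset.sum_range_add, ih, sum_range_succ, mul_add]
    congr 1
    rw [sum_mul]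
    refine Finset.sum_congr rfl fun s hs => ?_
    rw [coeff_mul_expand hN hP Q (mem_range.1 hs), norm_mul,
      Real.mul_rpow (norm_nonneg _) (norm_nonneg _)]

/-- The polynomial in `z ^ N_j` which is the factor number `j + 1` of the lacunary product. -/
noncomputable def lacunaryFactor (r : ℕ → ℝ) (j : ℕ) : ℂ[X] :=
  1 - C (1 / (2 : ℂ) ^ j) *
    ∑ i ∈ range (2 ^ j), C (1 / (r j : ℂ) ^ (circleCard j * 2 ^ i)) * X ^ 2 ^ i

theorem lacunaryPoly_succ (r : ℕ → ℝ) (k : ℕ) :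
    lacunaryPoly r (k + 1) =
      lacunaryPoly r k * expand ℂ (circleCard k) (lacunaryFactor r k) := by
  unfold lacunaryPoly lacunaryFactor
  rw [prod_range_succ]
  congr 1
  simp only [map_sub, map_one, map_mul, map_sum, map_pow, expand_C, expand_X, ← pow_mul]

theorem lacunaryFactor_coeff (r : ℕ → ℝ) (j m : ℕ) :
    (lacunaryFactor r j).coeff m = (if m = 0 then 1 else 0) -
      1 / (2 : ℂ) ^ j * ∑ i ∈ range (2 ^ j),
        if m = 2 ^ i then 1 / (r j : ℂ) ^ (circleCard j * 2 ^ i) else 0 := by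
  simp [lacunaryFactor, coeff_one, finsetSum_coeff, coeff_X_pow]

theorem lacunaryFactor_coeff_zero (r : ℕ → ℝ) (j : ℕ) : (lacunaryFactor r j).coeff 0 = 1 := by
  have h (i : ℕ) : (0 : ℕ) ≠ 2 ^ i := (by positivity : 0 < 2 ^ i).ne
  simp [lacunaryFactor_coeff, h]

theorem lacunaryFactor_degree_le (r : ℕ → ℝ) (j : ℕ) :
    (lacunaryFactor r j).natDegree ≤ circleCard j := by
  unfold lacunaryFactor
  refine (natDegree_sub_le _ _).trans (max_le (by simp) ((natDegree_C_mul_le _ _).trans ?_))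
  refine natDegree_sum_le_of_forall_le _ _ fun i hi => (natDegree_C_mul_X_pow_le _ _).trans ?_
  -- The top exponent `2 ^ (2 ^ j - 1)` is exactly `circleCard j`.
  exact Nat.pow_le_pow_right two_pos (Nat.le_sub_one_of_lt (mem_range.1 hi))

/-- The new degree is below `N_k + N_k * N_k ≤ 2 * N_k ^ 2 = N_{k+1}`. -/
theorem lacunaryPoly_degree_lt (r : ℕ → ℝ) (k : ℕ) :
    (lacunaryPoly r k).degree < circleCard k := by
  induction k with
  | zero => simp [lacunaryPoly, circleCard_zero]
  | succ k ih =>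
    rw [lacunaryPoly_succ]
    refine (degree_mul_le _ _).trans_lt ?_
    have h : (expand ℂ (circleCard k) (lacunaryFactor r k)).degree ≤
        ((circleCard k * circleCard k : ℕ) : WithBot ℕ) := by
      refine degree_le_of_natDegree_le ?_
      rw [natDegree_expand]
      exact Nat.mul_le_mul_right _ (lacunaryFactor_degree_le r k)
    refine (add_le_add_right h _).trans_lt ?_
    refine (WithBot.add_lt_add_right (WithBot.coe_ne_bot) ih).trans_le ?_
    rw [circleCard_succ]
    have := Nat.le_mul_self (circleCard k)
    have h2 : ((circleCard k + circleCard k * circleCard k : ℕ) : WithBot ℕ) ≤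
        ((2 * circleCard k ^ 2 : ℕ) : WithBot ℕ) := Nat.cast_le.2 (by rw [sq]; omega)
    refine le_trans (le_of_eq ?_) h2
    rw [Nat.cast_add]
    rfl

/-- The next factor is `1` plus terms of degree at least `N_k`, so the lower coefficients are
already final. -/
theorem lacunaryPoly_coeff_succ (r : ℕ → ℝ) {k n : ℕ} (hn : n < circleCard k) :
    (lacunaryPoly r (k + 1)).coeff n = (lacunaryPoly r k).coeff n := by
  have := coeff_mul_expand (circleCard_pos k) (lacunaryPoly_degree_lt r k) (lacunaryFactor r k) hn 0
  rw [mul_zero, zero_add, lacunaryFactor_coeff_zero, mul_one] at this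
  rw [lacunaryPoly_succ, this]

theorem lacunaryPoly_coeff_of_le (r : ℕ → ℝ) {k m n : ℕ} (hn : n < circleCard k) (h : k ≤ m) :
    (lacunaryPoly r m).coeff n = (lacunaryPoly r k).coeff n := by
  induction m, h using Nat.le_induction with
  | base => rfl
  | succ m hm ih =>
    rw [lacunaryPoly_coeff_succ r (hn.trans_le (strictMono_circleCard.monotone hm)), ih]

theorem weight_nonneg (p : ℝ) {r : ℕ → ℝ} {j : ℕ} (hr : 0 ≤ r j) : 0 ≤ weight p r j := by
  unfold weight; positivity

theorem sum_lacunaryFactor_coeff_le {p : ℝ} (hp : 1 < p) {r : ℕ → ℝ} {j : ℕ}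
    (hr : 0 < r j) (hr1 : r j < 1) (M : ℕ) :
    ∑ m ∈ range M, ‖(lacunaryFactor r j).coeff m‖ ^ p ≤ 1 + weight p r j := by
  -- Common bound for the `2 ^ j` nonconstant coefficients: their exponents are at most `N_j ^ 2`
  -- and `r j < 1`.
  set D : ℝ := (2 ^ j)⁻¹ * (r j ^ (circleCard j ^ 2))⁻¹ with hD
  have hD0 : 0 ≤ D := by positivity
  have hp0 : p ≠ 0 := by linarith
  have hpt (m : ℕ) : ‖(lacunaryFactor r j).coeff m‖ ^ p ≤ (if m = 0 then 1 else 0) +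
      ∑ i ∈ range (2 ^ j), if m = 2 ^ i then D ^ p else 0 := by
    have hnn : 0 ≤ ∑ i ∈ range (2 ^ j), if m = 2 ^ i then D ^ p else 0 :=
      sum_nonneg fun i _ => by split_ifs <;> positivity
    rcases eq_or_ne m 0 with rfl | hm
    · rw [lacunaryFactor_coeff_zero, if_pos rfl]
      simpa using hnn
    rw [lacunaryFactor_coeff, if_neg hm, if_neg hm, zero_sub, norm_neg, zero_add, norm_mul]
    by_cases h : ∃ i ∈ range (2 ^ j), m = 2 ^ i
    · obtain ⟨i, hi, rfl⟩ := h
      have hinj (i' : ℕ) : 2 ^ i = 2 ^ i' ↔ i = i' := (Nat.pow_right_injective le_rfl).eq_iff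
      simp only [hinj, sum_ite_eq, hi, if_true]
      refine Real.rpow_le_rpow (by positivity) ?_ (by linarith)
      rw [hD]
      simp only [norm_inv, norm_pow, one_div, Complex.norm_ofNat, Complex.norm_real,
        Real.norm_of_nonneg hr.le]
      have : (0 : ℝ) < r j ^ circleCard j ^ 2 := by positivity
      refine mul_le_mul_of_nonneg_left (inv_anti₀ this ?_) (by positivity)
      refine pow_le_pow_of_le_one hr.le hr1.le ?_
      rw [sq]
      exact Nat.mul_le_mul_left _
        (Nat.pow_le_pow_right two_pos (Nat.le_sub_one_of_lt (mem_range.1 hi)))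
    · push Not at h
      rw [sum_eq_zero fun i hi => if_neg (h i hi)]
      simpa [Real.zero_rpow hp0] using hnn
  have hw : (2 : ℝ) ^ j * D ^ p = weight p r j := by
    rw [hD, Real.mul_rpow (by positivity) (by positivity), Real.inv_rpow (by positivity),
      Real.inv_rpow (by positivity), weight, ← Real.rpow_natCast, ← Real.rpow_mul (by positivity),
      ← Real.rpow_natCast, ← Real.rpow_mul hr.le, one_div, mul_inv, ← mul_assoc, mul_sub, mul_one,
      Real.rpow_sub two_pos, inv_div, Nat.cast_pow, div_eq_mul_inv]
  calc _ ≤ ∑ m ∈ range M, ((if m = 0 then 1 else 0) +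
      ∑ i ∈ range (2 ^ j), if m = 2 ^ i then D ^ p else 0) := sum_le_sum fun m _ => hpt m
    _ = (∑ m ∈ range M, if m = 0 then 1 else 0) +
        ∑ i ∈ range (2 ^ j), ∑ m ∈ range M, if m = 2 ^ i then D ^ p else 0 := by
      rw [sum_add_distrib, sum_comm (s := range M)]
    _ ≤ 1 + ∑ i ∈ range (2 ^ j), D ^ p := by
      gcongr with i hi
      · rw [sum_ite_eq' (range M)]; split_ifs <;> norm_num
      · rw [sum_ite_eq' (range M)]; split_ifs
        · rfl
        · positivity
    _ = 1 + weight p r j := by rw [sum_const, card_range, nsmul_eq_mul, ← hw]; push_cast; rfl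

theorem sum_lacunaryPoly_coeff_le {p : ℝ} (hp : 1 < p) {r : ℕ → ℝ}
    (hr : ∀ j, 0 < r j ∧ r j < 1) (k : ℕ) :
    ∑ n ∈ range (circleCard k), ‖(lacunaryPoly r k).coeff n‖ ^ p ≤
      ∏ j ∈ range k, (1 + weight p r j) := by
  induction k with
  | zero => simp [lacunaryPoly, circleCard_zero]
  | succ k ih =>
    have h : circleCard (k + 1) = circleCard k * (2 * circleCard k) := by
      rw [circleCard_succ]; ring
    rw [lacunaryPoly_succ, h, sum_coeff_mul_expand (circleCard_pos k) (lacunaryPoly_degree_lt r k),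
      prod_range_succ]
    exact mul_le_mul ih (sum_lacunaryFactor_coeff_le hp (hr k).1 (hr k).2 _)
      (sum_nonneg fun _ _ => by positivity)
      (prod_nonneg fun j _ => add_nonneg zero_le_one (weight_nonneg p (hr j).1.le))

theorem exists_lp_lacunaryPoly {p : ℝ} (hp : 1 < p) {r : ℕ → ℝ}
    (hr : ∀ j, 0 < r j ∧ r j < 1) (k : ℕ) :
    ∃ F : EllPA p, (∀ n, F n = (lacunaryPoly r k).coeff n) ∧
      ‖F‖ ^ p ≤ ∏ j ∈ range k, (1 + weight p r j) := by
  have hp0 : 0 < p := by linarith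
  have hpt : (ENNReal.ofReal p).toReal = p := ENNReal.toReal_ofReal hp0.le
  have hz (n : ℕ) (hn : n ∉ range (circleCard k)) : ‖(lacunaryPoly r k).coeff n‖ ^ p = 0 := by
    rw [coeff_eq_zero_of_degree_lt, norm_zero, Real.zero_rpow hp0.ne']
    exact (lacunaryPoly_degree_lt r k).trans_le (by simpa using hn)
  have hmem : Memℓp (E := fun _ : ℕ => ℂ) (fun n => (lacunaryPoly r k).coeff n)
      (ENNReal.ofReal p) := by
    refine memℓp_gen ?_
    rw [hpt]
    exact summable_of_ne_finset_zero hz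
  refine ⟨⟨_, hmem⟩, fun n => rfl, ?_⟩
  have := lp.norm_rpow_eq_tsum (by rw [hpt]; exact hp0)
    (⟨_, hmem⟩ : lp (fun _ : ℕ => ℂ) (ENNReal.ofReal p))
  rw [hpt] at this
  rw [this, tsum_eq_sum hz]
  exact sum_lacunaryPoly_coeff_le hp hr k

/-! ### Enumeration of the points, circle after circle. -/

theorem blockStart_succ (k : ℕ) : blockStart (k + 1) = blockStart k + circleCard k :=
  sum_range_succ _ _

theorem monotone_blockStart : Monotone blockStart :=
  monotone_nat_of_le_succ fun k => by rw [blockStart_succ]; omega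

theorem le_blockStart (j : ℕ) : j ≤ blockStart j := by
  induction j with
  | zero => exact Nat.zero_le _
  | succ j ih => rw [blockStart_succ]; have := circleCard_pos j; omega

theorem blockStart_le_circleCard (j : ℕ) : blockStart j ≤ circleCard j := by
  induction j with
  | zero => exact Nat.zero_le _
  | succ j ih => rw [blockStart_succ, circleCard_succ]; nlinarith [circleCard_pos j]

theorem blockStart_blockIndex_le (n : ℕ) : blockStart (blockIndex n) ≤ n :=
  Nat.findGreatest_spec (P := fun j => blockStart j ≤ n) (Nat.zero_le n)
    (by simp [blockStart])

theorem lt_blockStart_blockIndex_succ (n : ℕ) : n < blockStart (blockIndex n + 1) := by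
  by_contra! h
  have : blockIndex n + 1 ≤ blockIndex n :=
    Nat.le_findGreatest ((le_blockStart _).trans h) h
  omega

theorem blockIndex_eq {n j : ℕ} (h : blockStart j ≤ n) (h' : n < blockStart (j + 1)) :
    blockIndex n = j := by
  have h1 := blockStart_blockIndex_le n
  have h2 := lt_blockStart_blockIndex_succ n
  rcases lt_trichotomy (blockIndex n) j with hj | hj | hj
  · have := monotone_blockStart (Nat.succ_le_of_lt hj); simp only [Nat.succ_eq_add_one] at this; omega
  · exact hj
  · have := monotone_blockStart (Nat.succ_le_of_lt hj); simp only [Nat.succ_eq_add_one] at this; omega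

theorem monotone_blockIndex : Monotone blockIndex := by
  intro m n h
  by_contra! hlt
  have h1 := blockStart_blockIndex_le m
  have h2 := lt_blockStart_blockIndex_succ n
  have := monotone_blockStart (Nat.succ_le_of_lt hlt)
  simp only [Nat.succ_eq_add_one] at this
  omega

theorem tendsto_blockIndex : Tendsto blockIndex atTop atTop := by
  rw [tendsto_atTop_atTop]
  refine fun b => ⟨blockStart b, fun n hn => ?_⟩
  have := monotone_blockIndex hn
  rwa [blockIndex_eq le_rfl (by rw [blockStart_succ]; have := circleCard_pos b; omega)] at this

/-! ### Points on the circles and divisibility. -/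

/-- The root of unity `exp (2 π i / N_j)`. -/
noncomputable def circleRoot (j : ℕ) : ℂ := Complex.exp (2 * Real.pi * Complex.I / (circleCard j : ℂ))

theorem circleRoot_isPrimitiveRoot (j : ℕ) : IsPrimitiveRoot (circleRoot j) (circleCard j) :=
  Complex.isPrimitiveRoot_exp _ (circleCard_pos j).ne'

theorem norm_circleRoot (j : ℕ) : ‖circleRoot j‖ = 1 :=
  (circleRoot_isPrimitiveRoot j).norm'_eq_one (circleCard_pos j).ne'

theorem targetPoint_eq (r : ℕ → ℝ) (n : ℕ) :
    targetPoint r n = r (blockIndex n) *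
      circleRoot (blockIndex n) ^ (n - blockStart (blockIndex n)) := by
  unfold targetPoint circleRoot
  rw [← Complex.exp_nat_mul]
  congr 2
  ring

theorem targetPoint_blockStart_add (r : ℕ → ℝ) {k l : ℕ} (hl : l < circleCard k) :
    targetPoint r (blockStart k + l) = r k * circleRoot k ^ l := by
  rw [targetPoint_eq, blockIndex_eq (Nat.le_add_right _ _) (by rw [blockStart_succ]; omega),
    Nat.add_sub_cancel_left]

theorem norm_targetPoint {r : ℕ → ℝ} (hr : ∀ j, 0 < r j) (n : ℕ) :
    ‖targetPoint r n‖ = r (blockIndex n) := by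
  rw [targetPoint_eq, norm_mul, norm_pow, norm_circleRoot, one_pow, mul_one, Complex.norm_real,
    Real.norm_of_nonneg (hr _).le]

/-- The factorization of `1 - u ^ N` over the `N`-th roots of unity, at `u = z / r`. The points are
in the denominators, hence the inverse root in the proof. -/
theorem prod_one_sub_div_circle (r : ℂ) (j : ℕ) :
    ∏ l ∈ range (circleCard j), (1 - C (1 / (r * circleRoot j ^ l)) * X) =
      1 - (C (1 / r ^ circleCard j) * X ^ circleCard j : ℂ[X]) := by
  refine Polynomial.funext fun z => ?_
  have hω := (circleRoot_isPrimitiveRoot j).inv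
  have h := hω.pow_sub_pow_eq_prod_sub_mul (1 : ℂ) (z / r) (circleCard_pos j)
  rw [eval_prod]
  simp only [eval_sub, eval_one, eval_mul, eval_C, eval_X, eval_pow]
  rw [one_pow, div_pow] at h
  rw [one_div_mul_eq_div, h]
  refine prod_nbij (fun l => (circleRoot j)⁻¹ ^ l) (fun l _ => ?_) ?_ ?_ fun l _ => ?_
  · rw [mem_nthRootsFinset (circleCard_pos j), ← pow_mul, mul_comm, pow_mul, hω.pow_eq_one, one_pow]
  · intro a ha b hb hab
    exact hω.pow_inj (by simpa using ha) (by simpa using hb) hab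
  · intro x hx
    rw [mem_coe, mem_nthRootsFinset (circleCard_pos j)] at hx
    have : NeZero (circleCard j) := ⟨(circleCard_pos j).ne'⟩
    obtain ⟨i, hi, rfl⟩ := hω.eq_pow_of_pow_eq_one hx
    exact ⟨i, by simpa using hi, rfl⟩
  · rw [inv_pow]
    ring

theorem targetPoly_succ (r : ℕ → ℝ) (k : ℕ) :
    targetPoly r (k + 1) = targetPoly r k *
      expand ℂ (circleCard k) (1 - C (1 / (r k : ℂ) ^ circleCard k) * X) := by
  unfold targetPoly
  rw [blockStart_succ, Finset.prod_range_add]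
  congr 1
  simp only [map_sub, map_one, map_mul, expand_C, expand_X]
  rw [← prod_one_sub_div_circle]
  exact Finset.prod_congr rfl fun l hl => by
    rw [targetPoint_blockStart_add r (mem_range.1 hl)]

/-- Writing `1` as the mean of `2 ^ j` ones makes the factor the mean of the `1 - u ^ (2 ^ i)`, each
divisible by `1 - u`. -/
theorem one_sub_dvd_lacunaryFactor (r : ℕ → ℝ) (j : ℕ) :
    (1 - C (1 / (r j : ℂ) ^ circleCard j) * X) ∣ lacunaryFactor r j := by
  have h : lacunaryFactor r j = C (1 / (2 : ℂ) ^ j) * ∑ i ∈ range (2 ^ j),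
      (1 - (C (1 / (r j : ℂ) ^ circleCard j) * X) ^ 2 ^ i) := by
    unfold lacunaryFactor
    rw [sum_sub_distrib, mul_sub]
    congr 1
    · rw [sum_const, card_range, nsmul_eq_mul, mul_one, ← C_eq_natCast, ← C_mul]
      simp
    · simp only [mul_pow, ← C_pow, one_div, pow_mul, inv_pow]
  rw [h]
  refine dvd_mul_of_dvd_right (dvd_sum fun i _ => ?_) _
  simpa using sub_dvd_pow_sub_pow (1 : ℂ[X]) (C (1 / (r j : ℂ) ^ circleCard j) * X) (2 ^ i)

theorem targetPoly_dvd_lacunaryPoly (r : ℕ → ℝ) (k : ℕ) : targetPoly r k ∣ lacunaryPoly r k := by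
  induction k with
  | zero => simp [targetPoly, blockStart]
  | succ k ih =>
    rw [targetPoly_succ, lacunaryPoly_succ]
    obtain ⟨Q, hQ⟩ := one_sub_dvd_lacunaryFactor r k
    rw [hQ, map_mul]
    exact mul_dvd_mul ih (dvd_mul_right _ _)

theorem iteratedDeriv_polynomial_eval (P : ℂ[X]) (d : ℕ) :
    iteratedDeriv d (fun z => P.eval z) = fun z => (derivative^[d] P).eval z := by
  induction d with
  | zero => simp
  | succ d ih =>
    rw [iteratedDeriv_succ, ih, Function.iterate_succ_apply']
    funext z
    exact Polynomial.deriv _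

/-- If `w` has `c` earlier occurrences, these and the `n`-th give the divisor `(1 - z / w) ^ (c +
1)`, and `c` derivatives leave one factor. Radii may coincide here, so `c` need not be `0`. -/
theorem iteratedDeriv_lacunaryPoly_eq_zero {r : ℕ → ℝ} (hr : ∀ j, 0 < r j) {n k : ℕ}
    (hn : n < blockStart k) :
    iteratedDeriv ((range n).filter fun i => targetPoint r i = targetPoint r n).card
      (fun z => (lacunaryPoly r k).eval z) (targetPoint r n) = 0 := by
  set w := targetPoint r n with hw
  set c := ((range n).filter fun i => targetPoint r i = w).card with hc
  have hw0 : w ≠ 0 := by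
    rw [← norm_pos_iff, hw, norm_targetPoint hr]
    exact hr _
  have hpow : (1 - C (1 / w) * X) ^ (c + 1) ∣ lacunaryPoly r k := by
    refine dvd_trans ?_ (targetPoly_dvd_lacunaryPoly r k)
    have hsub : (range (n + 1)).filter (fun i => targetPoint r i = w) ⊆ range (blockStart k) :=
      (filter_subset _ _).trans (range_subset_range.2 hn)
    refine dvd_trans (dvd_of_eq ?_)
      (prod_dvd_prod_of_subset _ _ (fun i => 1 - C (1 / targetPoint r i) * X) hsub)
    rw [prod_congr rfl (g := fun _ => 1 - C (1 / w) * X) fun i hi => by rw [(mem_filter.1 hi).2],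
      prod_const, range_add_one, filter_insert, if_pos hw.symm, card_insert_of_notMem (by simp)]
  have h := pow_sub_dvd_iterate_derivative_of_pow_dvd c hpow
  rw [Nat.add_sub_cancel_left, pow_one] at h
  rw [iteratedDeriv_polynomial_eval]
  obtain ⟨Q, hQ⟩ := h
  simp [hQ, hw0]

/-! ### Passage to the infinite product. -/

theorem tendstoLocallyUniformlyOn_sum_mul_pow {a : ℕ → ℂ} {B : ℝ} (ha : ∀ n, ‖a n‖ ≤ B) :
    TendstoLocallyUniformlyOn (fun N z => ∑ n ∈ range N, a n * z ^ n)
      (fun z => ∑' n, a n * z ^ n) atTop (Metric.ball 0 1) := by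
  have hB : 0 ≤ B := (norm_nonneg _).trans (ha 0)
  intro u hu x hx
  rw [mem_ball_zero_iff] at hx
  obtain ⟨ρ, hxρ, hρ⟩ := exists_between hx
  have hρ0 : 0 ≤ ρ := (norm_nonneg x).trans hxρ.le
  have hsum : Summable fun n : ℕ => B * ρ ^ n := (summable_geometric_of_lt_one hρ0 hρ).mul_left B
  refine ⟨Metric.ball 0 ρ, mem_nhdsWithin_of_mem_nhds (Metric.isOpen_ball.mem_nhds (by simpa)),
    tendstoUniformlyOn_tsum_nat hsum (fun n z hz => ?_) u hu⟩
  rw [norm_mul, norm_pow]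
  exact mul_le_mul (ha n) (pow_le_pow_left₀ (norm_nonneg z) (mem_ball_zero_iff.1 hz).le n)
    (by positivity) hB

theorem TendstoLocallyUniformlyOn.iteratedDeriv {ι : Type*} {φ : Filter ι} {F : ι → ℂ → ℂ}
    {f : ℂ → ℂ} {U : Set ℂ} (hf : TendstoLocallyUniformlyOn F f φ U)
    (hF : ∀ i, Differentiable ℂ (F i)) (hU : IsOpen U) (d : ℕ) :
    TendstoLocallyUniformlyOn (fun i => iteratedDeriv d (F i)) (iteratedDeriv d f) φ U := by
  induction d with
  | zero => simpa using hf
  | succ d ih =>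
    simp only [iteratedDeriv_succ]
    refine ih.deriv (Eventually.of_forall fun i => Differentiable.differentiableOn ?_) hU
    exact (hF i).contDiff.differentiable_iteratedDeriv d (WithTop.coe_lt_top _)

/-- The coefficients of the infinite lacunary product. -/
noncomputable def lacunaryCoeff (r : ℕ → ℝ) (n : ℕ) : ℂ := (lacunaryPoly r n).coeff n

theorem lacunaryPoly_coeff_eq (r : ℕ → ℝ) {k n : ℕ} (hn : n < circleCard k) :
    (lacunaryPoly r k).coeff n = lacunaryCoeff r n := by
  unfold lacunaryCoeff
  rw [← lacunaryPoly_coeff_of_le r hn (le_max_left k n),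
    lacunaryPoly_coeff_of_le r (lt_circleCard n) (le_max_right k n)]

theorem lacunaryCoeff_zero (r : ℕ → ℝ) : lacunaryCoeff r 0 = 1 := by
  simp [lacunaryCoeff, lacunaryPoly]

/-- The products are a subsequence of the partial sums of the limit series. -/
theorem lacunaryPoly_eval (r : ℕ → ℝ) (k : ℕ) (z : ℂ) :
    (lacunaryPoly r k).eval z = ∑ n ∈ range (circleCard k), lacunaryCoeff r n * z ^ n := by
  have h : (lacunaryPoly r k).natDegree < circleCard k := by
    rcases eq_or_ne (lacunaryPoly r k) 0 with h0 | h0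
    · rw [h0]; exact circleCard_pos k
    · exact (natDegree_lt_iff_degree_lt h0).2 (lacunaryPoly_degree_lt r k)
  rw [eval_eq_sum_range' h]
  exact Finset.sum_congr rfl fun n hn => by rw [lacunaryPoly_coeff_eq r (mem_range.1 hn)]

theorem memℓp_lacunaryCoeff {p : ℝ} (hp : 1 < p) {r : ℕ → ℝ} (hr : ∀ j, 0 < r j ∧ r j < 1)
    (hs : Summable (weight p r)) :
    Memℓp (E := fun _ : ℕ => ℂ) (lacunaryCoeff r) (ENNReal.ofReal p) := by
  have hpt : (ENNReal.ofReal p).toReal = p := ENNReal.toReal_ofReal (by linarith)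
  refine memℓp_gen ?_
  rw [hpt]
  refine summable_of_sum_range_le (c := Real.exp (∑' j, weight p r j)) (fun n => by positivity)
    fun n => ?_
  calc ∑ i ∈ range n, ‖lacunaryCoeff r i‖ ^ p
      ≤ ∑ i ∈ range (circleCard n), ‖lacunaryCoeff r i‖ ^ p :=
        sum_le_sum_of_subset_of_nonneg (range_subset_range.2 (lt_circleCard n).le)
          fun _ _ _ => by positivity
    _ = ∑ i ∈ range (circleCard n), ‖(lacunaryPoly r n).coeff i‖ ^ p :=
        Finset.sum_congr rfl fun i hi => by rw [lacunaryPoly_coeff_eq r (mem_range.1 hi)]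
    _ ≤ ∏ j ∈ range n, (1 + weight p r j) := sum_lacunaryPoly_coeff_le hp hr n
    _ ≤ ∏ j ∈ range n, Real.exp (weight p r j) :=
        prod_le_prod (fun j _ => add_nonneg zero_le_one (weight_nonneg p (hr j).1.le))
          fun j _ => by rw [add_comm]; exact Real.add_one_le_exp _
    _ = Real.exp (∑ j ∈ range n, weight p r j) := (Real.exp_sum _ _).symm
    _ ≤ _ := Real.exp_le_exp.2 (hs.sum_le_tsum _ fun j _ => weight_nonneg p (hr j).1.le)

theorem isZeroSet_targetPoint {p : ℝ} (hp : 1 < p) {r : ℕ → ℝ} (hr : ∀ j, 0 < r j ∧ r j < 1)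
    (hs : Summable (weight p r)) : IsZeroSet p (targetPoint r) := by
  have hnorm (n : ℕ) : ‖targetPoint r n‖ < 1 := by
    rw [norm_targetPoint fun j => (hr j).1]
    exact (hr _).2
  have hp1 : ENNReal.ofReal p ≠ 0 := by simpa using by linarith
  refine ⟨hnorm, ⟨⟨_, memℓp_lacunaryCoeff hp hr hs⟩, fun n => ?_, fun h => ?_⟩⟩
  · set f : EllPA p := ⟨_, memℓp_lacunaryCoeff hp hr hs⟩ with hf
    have hb (n : ℕ) : ‖lacunaryCoeff r n‖ ≤ ‖f‖ := lp.norm_apply_le_norm hp1 f n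
    have hlim : TendstoLocallyUniformlyOn (fun k z => (lacunaryPoly r k).eval z) (EllPA.eval f)
        atTop (Metric.ball 0 1) := by
      intro u hu x hx
      obtain ⟨t, ht, h⟩ := tendstoLocallyUniformlyOn_sum_mul_pow hb u hu x hx
      refine ⟨t, ht, ?_⟩
      filter_upwards [strictMono_circleCard.tendsto_atTop.eventually h] with k hk y hy
      rw [lacunaryPoly_eval]
      exact hk y hy
    have h1 := (hlim.iteratedDeriv (fun k => (lacunaryPoly r k).differentiable) Metric.isOpen_ball
      ((range n).filter fun i => targetPoint r i = targetPoint r n).card).tendsto_at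
        (a := targetPoint r n) (by simpa using hnorm n)
    refine tendsto_nhds_unique h1 (tendsto_const_nhds.congr' ?_)
    filter_upwards [eventually_gt_atTop n] with k hk
    exact (iteratedDeriv_lacunaryPoly_eq_zero (fun j => (hr j).1)
      (hk.trans_le (le_blockStart k))).symm
  · have h0 : lacunaryCoeff r 0 = 0 := congrArg (fun g : EllPA p => g 0) h
    rw [lacunaryCoeff_zero] at h0
    exact one_ne_zero h0

end

section

open Finset

/-! ### The slow radii: existence and asymptotics. -/

theorem summable_one_div_mul_log_rpow {a : ℝ} (ha : 1 < a) :
    Summable fun j : ℕ => 1 / (((j : ℝ) + 1) * Real.log ((j : ℝ) + 1) ^ a) := by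
  have key : Summable fun n : ℕ => 1 / ((n : ℝ) * Real.log n ^ a) := by
    -- Cauchy condensation reduces the series to a multiple of `∑ 1 / k ^ a`.
    rw [← summable_condensed_iff_of_eventually_nonneg]
    · have h : Summable fun k : ℕ => (Real.log 2 ^ a)⁻¹ * (1 / (k : ℝ) ^ a) :=
        (Real.summable_one_div_nat_rpow.2 ha).mul_left _
      refine h.congr fun k => ?_
      rw [Nat.cast_pow, Nat.cast_ofNat, Real.log_pow, Real.mul_rpow (by positivity)
        (Real.log_nonneg one_le_two)]
      field_simp
    · filter_upwards [eventually_ge_atTop 1] with n hn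
      have : (0 : ℝ) ≤ Real.log n := Real.log_natCast_nonneg n
      simp only [Pi.zero_apply]
      positivity
    · filter_upwards [eventually_ge_atTop 2] with n hn
      have hn' : (1 : ℝ) < n := by exact_mod_cast hn
      have hlog : 0 < Real.log n := Real.log_pos hn'
      have hle : (n : ℝ) ≤ (n + 1 : ℕ) := by push_cast; linarith
      gcongr
  refine ((summable_nat_add_iff 1).2 key).congr fun j => ?_
  push_cast
  rfl

/-- The base of the power in the formula for the slow radii. -/
noncomputable def slowBase (p a : ℝ) (j : ℕ) : ℝ :=
  ((j : ℝ) + 1) * Real.log ((j : ℝ) + 1) ^ a / (2 : ℝ) ^ ((j : ℝ) * (p - 1))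

/-- The formula for the slow radii. -/
noncomputable def slowRadius (p a : ℝ) (j : ℕ) : ℝ :=
  slowBase p a j ^ (1 / ((circleCard j : ℝ) ^ 2 * p))

theorem slowBase_pos (p a : ℝ) {j : ℕ} (hj : 1 ≤ j) : 0 < slowBase p a j := by
  have hj' : (1 : ℝ) ≤ j := by exact_mod_cast hj
  have : 0 < Real.log ((j : ℝ) + 1) := Real.log_pos (by linarith)
  unfold slowBase
  positivity

theorem log_slowBase (p a : ℝ) {j : ℕ} (hj : 1 ≤ j) :
    Real.log (slowBase p a j) =
      Real.log (((j : ℝ) + 1) * Real.log ((j : ℝ) + 1) ^ a) - (j : ℝ) * (p - 1) * Real.log 2 := by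
  have hj' : (1 : ℝ) ≤ j := by exact_mod_cast hj
  have : 0 < Real.log ((j : ℝ) + 1) := Real.log_pos (by linarith)
  rw [slowBase, Real.log_div (by positivity) (by positivity), Real.log_rpow two_pos]

/-- The numerator of `slowBase` is at least `1` and at most a power of `j + 1`; half of the
exponential decay absorbs that power. -/
theorem eventually_log_slowBase_bounds {p a : ℝ} (hp : 1 < p) (ha : 1 < a) :
    ∀ᶠ j : ℕ in atTop, (p - 1) * Real.log 2 / 2 * j ≤ -Real.log (slowBase p a j) ∧
      -Real.log (slowBase p a j) ≤ (p - 1) * Real.log 2 * j := by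
  have hl2 : 0 < Real.log 2 := Real.log_pos one_lt_two
  set b := (p - 1) * Real.log 2 / 2 with hb
  have hb0 : 0 < b := by have := sub_pos.2 hp; positivity
  -- The constant `exp (-b)` compensates for the shift from `j` to `j + 1`.
  have ho := (isLittleO_rpow_exp_pos_mul_atTop (1 + a) hb0).bound (Real.exp_pos (-b))
  have ht : Tendsto (fun j : ℕ => (j : ℝ) + 1) atTop atTop :=
    tendsto_atTop_add_const_right _ _ tendsto_natCast_atTop_atTop
  filter_upwards [ht.eventually ho, eventually_ge_atTop 2] with j h hj
  have hj' : (2 : ℝ) ≤ j := by exact_mod_cast hj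
  have hx : 0 < (j : ℝ) + 1 := by linarith
  have hlog1 : 1 ≤ Real.log ((j : ℝ) + 1) := by
    rw [Real.le_log_iff_exp_le hx]
    linarith [Real.exp_one_lt_d9]
  have hlog2 : Real.log ((j : ℝ) + 1) ≤ (j : ℝ) + 1 := Real.log_le_self hx.le
  rw [log_slowBase p a (by omega)]
  constructor
  · have h1 : ((j : ℝ) + 1) * Real.log ((j : ℝ) + 1) ^ a ≤ Real.exp (b * j) := by
      calc ((j : ℝ) + 1) * Real.log ((j : ℝ) + 1) ^ a
          ≤ ((j : ℝ) + 1) * ((j : ℝ) + 1) ^ a := by gcongr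
        _ = ((j : ℝ) + 1) ^ (1 + a) := by rw [Real.rpow_add hx, Real.rpow_one]
        _ ≤ Real.exp (-b) * Real.exp (b * ((j : ℝ) + 1)) := by
          rwa [Real.norm_of_nonneg (by positivity), Real.norm_of_nonneg (by positivity)] at h
        _ = Real.exp (b * j) := by rw [← Real.exp_add]; ring_nf
    have h2 := Real.log_le_log (by positivity) h1
    rw [Real.log_exp] at h2
    rw [hb] at h2 ⊢
    linarith
  · have h1 : 1 ≤ ((j : ℝ) + 1) * Real.log ((j : ℝ) + 1) ^ a :=
      one_le_mul_of_one_le_of_one_le (by linarith) (Real.one_le_rpow hlog1 (by linarith))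
    have := Real.log_nonneg h1
    linarith

theorem slowRadius_eq_exp (p a : ℝ) {j : ℕ} (hj : 1 ≤ j) :
    slowRadius p a j =
      Real.exp (-(-Real.log (slowBase p a j) / ((circleCard j : ℝ) ^ 2 * p))) := by
  rw [slowRadius, Real.rpow_def_of_pos (slowBase_pos p a hj)]
  congr 1
  ring

theorem eventually_slowRadius_lt_one {p a : ℝ} (hp : 1 < p) (ha : 1 < a) :
    ∀ᶠ j : ℕ in atTop, slowRadius p a j < 1 := by
  filter_upwards [eventually_log_slowBase_bounds hp ha, eventually_ge_atTop 1] with j h hj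
  have hl2 : 0 < Real.log 2 := Real.log_pos one_lt_two
  have hN : (0 : ℝ) < circleCard j := by exact_mod_cast circleCard_pos j
  have hj' : (0 : ℝ) < j := by exact_mod_cast hj
  have hp' := sub_pos.2 hp
  rw [slowRadius_eq_exp p a hj, Real.exp_lt_one_iff, neg_lt_zero]
  exact div_pos (lt_of_lt_of_le (by positivity) h.1) (by positivity)

/-- `-log r_j` is comparable to `j / N_j ^ 2`, and `N_{j+1} ^ 2 = 4 * N_j ^ 4` outweighs the growth
of `j`. -/
theorem eventually_slowRadius_lt_succ {p a : ℝ} (hp : 1 < p) (ha : 1 < a) :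
    ∀ᶠ j : ℕ in atTop, slowRadius p a j < slowRadius p a (j + 1) := by
  have hb := eventually_log_slowBase_bounds hp ha
  filter_upwards [hb, (tendsto_add_atTop_nat 1).eventually hb, eventually_ge_atTop 2]
    with j h h' hj
  have hκ : 0 < (p - 1) * Real.log 2 := mul_pos (sub_pos.2 hp) (Real.log_pos one_lt_two)
  have hN : (1 : ℝ) ≤ circleCard j := by exact_mod_cast circleCard_pos j
  have hj' : (2 : ℝ) ≤ j := by exact_mod_cast hj
  have hp0 : 0 < p := by linarith
  rw [slowRadius_eq_exp p a (by omega), slowRadius_eq_exp p a (by omega : 1 ≤ j + 1), Real.exp_lt_exp,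
    neg_lt_neg_iff, circleCard_succ]
  push_cast at h' ⊢
  set κ := (p - 1) * Real.log 2
  set N : ℝ := (circleCard j : ℝ)
  have hN2 : 1 ≤ N ^ 2 := one_le_pow₀ hN
  calc _ ≤ κ * (j + 1) / ((2 * N ^ 2) ^ 2 * p) := by gcongr; exact h'.2
    _ < κ / 2 * j / (N ^ 2 * p) := by
      rw [div_lt_div_iff₀ (by positivity) (by positivity)]
      have h1 : (j : ℝ) + 1 < 2 * j * N ^ 2 := by nlinarith
      have h2 : 0 < κ * N ^ 2 * p := by positivity
      nlinarith [mul_lt_mul_of_pos_left h1 h2]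
    _ ≤ _ := by gcongr; exact h.1

theorem tendsto_slowRadius {p a : ℝ} (hp : 1 < p) (ha : 1 < a) :
    Tendsto (slowRadius p a) atTop (𝓝 1) := by
  have hκ : 0 < (p - 1) * Real.log 2 := mul_pos (sub_pos.2 hp) (Real.log_pos one_lt_two)
  have hp0 : 0 < p := by linarith
  have hlow : Tendsto (fun j : ℕ => 1 - (p - 1) * Real.log 2 / p / (j : ℝ)) atTop (𝓝 1) := by
    simpa using tendsto_const_nhds.sub
      (tendsto_const_div_atTop_nhds_zero_nat ((p - 1) * Real.log 2 / p))
  refine tendsto_of_tendsto_of_tendsto_of_le_of_le' hlow tendsto_const_nhds ?_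
    ((eventually_slowRadius_lt_one hp ha).mono fun _ h => h.le)
  filter_upwards [eventually_log_slowBase_bounds hp ha, eventually_ge_atTop 1] with j h hj
  have hj' : (1 : ℝ) ≤ j := by exact_mod_cast hj
  have hN : (j : ℝ) ≤ circleCard j := by exact_mod_cast (lt_circleCard j).le
  rw [slowRadius_eq_exp p a hj]
  refine le_trans ?_ (Real.one_sub_le_exp_neg _)
  refine sub_le_sub_left ?_ 1
  calc _ ≤ (p - 1) * Real.log 2 * j / ((j : ℝ) ^ 2 * p) := by
        gcongr
        exact h.2
    _ = _ := by field_simp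

theorem eventually_le_one_sub_slowRadius {p a : ℝ} (hp : 1 < p) (ha : 1 < a) :
    ∃ c : ℝ, 0 < c ∧ ∀ᶠ j : ℕ in atTop, c / (circleCard j : ℝ) ^ 2 ≤ 1 - slowRadius p a j := by
  have hκ : 0 < (p - 1) * Real.log 2 := mul_pos (sub_pos.2 hp) (Real.log_pos one_lt_two)
  have hp0 : 0 < p := by linarith
  set b := (p - 1) * Real.log 2 / 2 / p with hb
  have hb0 : 0 < b := by positivity
  refine ⟨b / (1 + b), by positivity, ?_⟩
  filter_upwards [eventually_log_slowBase_bounds hp ha, eventually_ge_atTop 1] with j h hj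
  have hj' : (1 : ℝ) ≤ j := by exact_mod_cast hj
  have hN : (1 : ℝ) ≤ circleCard j := by exact_mod_cast circleCard_pos j
  rw [slowRadius_eq_exp p a hj]
  set N : ℝ := (circleCard j : ℝ)
  have hN2 : 1 ≤ N ^ 2 := one_le_pow₀ hN
  have hs : b / N ^ 2 ≤ -Real.log (slowBase p a j) / (N ^ 2 * p) := by
    calc b / N ^ 2 = (p - 1) * Real.log 2 / 2 * 1 / (N ^ 2 * p) := by rw [hb]; field_simp
      _ ≤ _ := by
        gcongr
        exact le_trans (by gcongr) h.1
  -- From `exp s ≥ 1 + s`; then `N ≥ 1` gives the constant `b / (1 + b)`.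
  have h1 : Real.exp (-(-Real.log (slowBase p a j) / (N ^ 2 * p))) ≤ (1 + b / N ^ 2)⁻¹ := by
    rw [Real.exp_neg]
    gcongr
    rw [add_comm]
    exact (Real.add_one_le_exp _).trans (Real.exp_le_exp.2 hs)
  have h2 : b / (1 + b) / N ^ 2 ≤ 1 - (1 + b / N ^ 2)⁻¹ := by
    have : 1 - (1 + b / N ^ 2)⁻¹ = b / (N ^ 2 + b) := by field_simp; ring
    rw [this, div_div]
    gcongr
    nlinarith
  linarith

theorem exists_isSlowRadii {p a : ℝ} (hp : 1 < p) (ha : 1 < a) : ∃ r, IsSlowRadii p a r := by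
  obtain ⟨J, hJ⟩ := eventually_atTop.1 ((eventually_slowRadius_lt_one hp ha).and
    ((eventually_slowRadius_lt_succ hp ha).and (eventually_ge_atTop 1)))
  have hpos {j : ℕ} (hj : J ≤ j) : 0 < slowRadius p a j :=
    Real.rpow_pos_of_pos (slowBase_pos p a (hJ j hj).2.2) _
  have hJ0 : 0 < slowRadius p a J := hpos le_rfl
  have hr1 {j : ℕ} (hj : j < J) :
      slowRadius p a J * ((j + 1) / (J + 1)) < slowRadius p a J := by
    refine mul_lt_of_lt_one_right hJ0 ?_
    rw [div_lt_one (by positivity)]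
    have : (j : ℝ) < J := by exact_mod_cast hj
    linarith
  -- The formula is used only from `J` on; below `J`, a linear ramp stays under `slowRadius p a J`.
  refine ⟨fun j => if j < J then slowRadius p a J * ((j + 1) / (J + 1)) else slowRadius p a j,
    fun j => ?_, strictMono_nat_of_lt_succ fun j => ?_, ?_⟩
  · dsimp only
    split_ifs with hj
    · exact ⟨by positivity, (hr1 hj).trans (hJ J le_rfl).1⟩
    · exact ⟨hpos (not_lt.1 hj), (hJ j (not_lt.1 hj)).1⟩
  · rcases lt_trichotomy (j + 1) J with h | h | h
    · rw [if_pos (by omega), if_pos h]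
      push_cast
      gcongr
      linarith
    · rw [if_pos (by omega), if_neg (by omega), h]
      exact hr1 (by omega)
    · rw [if_neg (by omega), if_neg (by omega)]
      exact (hJ j (by omega)).2.1
  · filter_upwards [eventually_ge_atTop J] with j hj
    rw [if_neg (by omega)]
    rfl

theorem IsSlowRadii.eventually_eq {p a : ℝ} {r : ℕ → ℝ} (h : IsSlowRadii p a r) :
    r =ᶠ[atTop] slowRadius p a := h.2.2

theorem IsSlowRadii.summable_weight {p a : ℝ} (hp : 1 < p) (ha : 1 < a) {r : ℕ → ℝ}
    (h : IsSlowRadii p a r) : Summable (weight p r) := by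
  refine (summable_one_div_mul_log_rpow ha).congr_atTop ?_
  filter_upwards [h.eventually_eq, eventually_ge_atTop 1] with j hj hj1
  have hN : (0 : ℝ) < circleCard j := by exact_mod_cast circleCard_pos j
  have hp0 : 0 < p := by linarith
  -- The exponents cancel: `r_j ^ (N_j ^ 2 * p)` is `slowBase p a j`.
  rw [weight, hj, slowRadius, ← Real.rpow_mul (slowBase_pos p a hj1).le,
    one_div_mul_cancel (by positivity), Real.rpow_one, slowBase, mul_div_cancel₀ _ (by positivity)]

/-! ### Geometry of the point sequence. -/

theorem injective_targetPoint {r : ℕ → ℝ} (hr : ∀ j, 0 < r j) (hinj : Function.Injective r) :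
    Function.Injective (targetPoint r) := by
  intro m n h
  have hb : blockIndex m = blockIndex n := by
    apply hinj
    rw [← norm_targetPoint hr, ← norm_targetPoint hr, h]
  have hm := blockStart_blockIndex_le m
  have hn := blockStart_blockIndex_le n
  have hm' := lt_blockStart_blockIndex_succ m
  have hn' := lt_blockStart_blockIndex_succ n
  rw [targetPoint_eq, targetPoint_eq] at h
  rw [hb] at h hm hm'
  rw [blockStart_succ] at hm' hn'
  have hpow := mul_left_cancel₀ (by exact_mod_cast (hr _).ne') h
  have := (circleRoot_isPrimitiveRoot _).pow_inj (by omega) (by omega) hpow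
  omega

theorem monotone_norm_targetPoint {r : ℕ → ℝ} (hr : ∀ j, 0 < r j) (hmono : Monotone r) :
    Monotone fun n => ‖targetPoint r n‖ := by
  simp only [norm_targetPoint hr]
  exact hmono.comp monotone_blockIndex

/-- The previous circle is already listed, so its cardinality is at most `n`; the current one is
twice its square. -/
theorem circleCard_blockIndex_le (n : ℕ) : circleCard (blockIndex n) ≤ 2 * (n + 1) ^ 2 := by
  have h := blockStart_blockIndex_le n
  rcases hj : blockIndex n with _ | i
  · rw [circleCard_zero]
    nlinarith
  · rw [hj, blockStart_succ] at h
    rw [circleCard_succ]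
    gcongr
    omega

theorem tendsto_pow_div_one_sub_norm {p a : ℝ} (hp : 1 < p) (ha : 1 < a) {r : ℕ → ℝ}
    (h : IsSlowRadii p a r) {c : ℝ} (hc : 0 < c) (hc1 : c < 1) :
    Tendsto (fun n : ℕ => c ^ n / (1 - ‖targetPoint r n‖)) atTop (𝓝 0) := by
  obtain ⟨b, hb, hev⟩ := eventually_le_one_sub_slowRadius hp ha
  -- The bound `N ≤ 2 * (n + 1) ^ 2` gives `N ^ 2 ≤ 4 * (n + 1) ^ 4`; the `c` in the denominator
  -- turns `c ^ (n + 1)` into `c ^ n`.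
  have ht : Tendsto (fun n : ℕ => 4 / (b * c) * (((n + 1 : ℕ) : ℝ) ^ 4 * c ^ (n + 1))) atTop
      (𝓝 0) := by
    have h0 := (tendsto_add_atTop_iff_nat 1).2
      (tendsto_pow_const_mul_const_pow_of_abs_lt_one 4 (abs_lt.2 ⟨by linarith, hc1⟩))
    simpa using h0.const_mul (4 / (b * c))
  have hsub (n : ℕ) : 0 < 1 - ‖targetPoint r n‖ := by
    rw [norm_targetPoint fun j => (h.1 j).1]
    exact sub_pos.2 (h.1 _).2
  refine squeeze_zero' (Eventually.of_forall fun n => div_nonneg (by positivity) (hsub n).le) ?_ ht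
  filter_upwards [tendsto_blockIndex.eventually hev,
    tendsto_blockIndex.eventually h.eventually_eq] with n hn hrn
  rw [← hrn, ← norm_targetPoint fun j => (h.1 j).1] at hn
  have hN : (circleCard (blockIndex n) : ℝ) ≤ 2 * ((n : ℝ) + 1) ^ 2 := by
    exact_mod_cast circleCard_blockIndex_le n
  have hN0 : (0 : ℝ) < circleCard (blockIndex n) := by exact_mod_cast circleCard_pos _
  have hn' : b / (2 * ((n : ℝ) + 1) ^ 2) ^ 2 ≤ 1 - ‖targetPoint r n‖ :=
    le_trans (by gcongr) hn
  calc c ^ n / (1 - ‖targetPoint r n‖) ≤ c ^ n / (b / (2 * ((n : ℝ) + 1) ^ 2) ^ 2) := by gcongr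
    _ = _ := by push_cast; field_simp; ring

/-- Moduli increase strictly along a Newman–Shapiro sequence, so each of the `m` sequences has at
most one point on circle `m`, which carries more than `m` points. -/
theorem not_coveredByNewmanShapiro {r : ℕ → ℝ} (hr : ∀ j, 0 < r j)
    (hinj : Function.Injective r) : ¬ CoveredByNewmanShapiro (targetPoint r) := by
  rintro ⟨m, v, hv, hsub⟩
  have hmem (n : ℕ) : ∃ i k, v i k = targetPoint r n := by
    simpa using hsub ⟨n, rfl⟩
  choose i k hik using hmem
  obtain ⟨x, y, hxy, hi⟩ := Fintype.exists_ne_map_eq_of_card_lt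
    (fun l : Fin (circleCard m) => i (blockStart m + l)) (by simpa using lt_circleCard m)
  have hnorm (l : Fin (circleCard m)) : ‖targetPoint r (blockStart m + l)‖ = r m := by
    rw [norm_targetPoint hr, blockIndex_eq (Nat.le_add_right _ _)
      (by rw [blockStart_succ]; have := l.2; omega)]
  obtain ⟨hlt, c, hc, hc1, hcv⟩ := hv (i (blockStart m + x))
  have hmono : StrictMono fun k => ‖v (i (blockStart m + x)) k‖ :=
    strictMono_nat_of_lt_succ fun k => by
      have h1 := hcv k
      have h2 : 0 < 1 - ‖v (i (blockStart m + x)) k‖ := sub_pos.2 (hlt k)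
      nlinarith
  have hk : k (blockStart m + x) = k (blockStart m + y) := by
    apply hmono.injective
    dsimp only
    rw [hik, hi, hik, hnorm, hnorm]
  have : targetPoint r (blockStart m + x) = targetPoint r (blockStart m + y) := by
    rw [← hik, ← hik, hi, hk]
  exact hxy (Fin.ext (Nat.add_left_cancel (injective_targetPoint hr hinj this)))

/-! ### Two-sided estimates in terms of the position. -/

/-- Position of the indices in the circle number `i + 2`. -/
theorem logb_bounds_of_blockIndex_eq {n i : ℕ} (hn : blockIndex n = i + 1) :
    (2 : ℝ) ^ i ≤ 1 + Real.logb 2 (n + 1) ∧ 1 + Real.logb 2 (n + 1) ≤ 2 ^ (i + 2) ∧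
      (i : ℝ) ≤ loglog (n + 1) ∧ loglog (n + 1) ≤ i + 2 := by
  have h1 := blockStart_blockIndex_le n
  have h2 := lt_blockStart_blockIndex_succ n
  rw [hn, blockStart_succ] at h1 h2
  have h3 := blockStart_le_circleCard (i + 1)
  have h4 := two_mul_circleCard (i + 1)
  have hlow : (2 : ℝ) ^ i ≤ 1 + Real.logb 2 (n + 1) := by
    have h : (2 : ℝ) ^ 2 ^ i ≤ 2 * (n + 1) := by
      exact_mod_cast (by rw [← two_mul_circleCard i]; omega : 2 ^ 2 ^ i ≤ 2 * (n + 1))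
    have := Real.logb_le_logb_of_le one_lt_two (by positivity) h
    rw [Real.logb_mul two_ne_zero (by positivity), Real.logb_self_eq_one one_lt_two,
      Real.logb_pow, Real.logb_self_eq_one one_lt_two, mul_one] at this
    exact_mod_cast this
  have hup : 1 + Real.logb 2 (n + 1) ≤ 2 ^ (i + 2) := by
    have h : ((n : ℝ) + 1) ≤ (2 : ℝ) ^ 2 ^ (i + 1) := by
      exact_mod_cast (by omega : n + 1 ≤ 2 ^ 2 ^ (i + 1))
    have := Real.logb_le_logb_of_le one_lt_two (by positivity) h
    rw [Real.logb_pow, Real.logb_self_eq_one one_lt_two, mul_one] at this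
    push_cast at this
    have h1 : (1 : ℝ) ≤ 2 ^ (i + 1) := one_le_pow₀ one_le_two
    rw [pow_succ _ (i + 1)]
    linarith
  refine ⟨hlow, hup, ?_, ?_⟩
  · have := Real.logb_le_logb_of_le one_lt_two (by positivity) hlow
    rwa [Real.logb_pow, Real.logb_self_eq_one one_lt_two, mul_one] at this
  · have := Real.logb_le_logb_of_le one_lt_two (lt_of_lt_of_le (by positivity) hlow) hup
    rw [Real.logb_pow, Real.logb_self_eq_one one_lt_two, mul_one] at this
    exact_mod_cast this

/-- Here `2 ^ (i + 1)` lies within a factor `2` of `1 + logb 2 (n + 1)`, and `i + 2` lies between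
`loglog (n + 1)` and that plus `2`. The condition `1 ≤ i` makes the logarithms nonnegative. -/
theorem slowBase_bounds_of_blockIndex_eq {p a : ℝ} (hp : 1 < p) (ha : 1 < a) {n i : ℕ}
    (hi : 1 ≤ i) (hn : blockIndex n = i + 1) :
    loglog (n + 1) * Real.log (loglog (n + 1)) ^ a /
        (2 * (1 + Real.logb 2 (n + 1))) ^ (p - 1) ≤ slowBase p a (i + 1) ∧
      slowBase p a (i + 1) ≤ (2 + loglog (n + 1)) * Real.log (2 + loglog (n + 1)) ^ a /
        ((1 / 2) * (1 + Real.logb 2 (n + 1))) ^ (p - 1) ∧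
      0 ≤ loglog (n + 1) * Real.log (loglog (n + 1)) ^ a /
        (2 * (1 + Real.logb 2 (n + 1))) ^ (p - 1) := by
  obtain ⟨h1, h2, h3, h4⟩ := logb_bounds_of_blockIndex_eq hn
  have hi' : (1 : ℝ) ≤ i := by exact_mod_cast hi
  have hp' : 0 < p - 1 := sub_pos.2 hp
  have hden : (2 : ℝ) ^ (((i + 1 : ℕ) : ℝ) * (p - 1)) = ((2 : ℝ) ^ (i + 1)) ^ (p - 1) := by
    rw [Real.rpow_mul zero_le_two, Real.rpow_natCast]
  unfold slowBase
  rw [hden]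
  push_cast
  set L := loglog (n + 1)
  set l := 1 + Real.logb 2 (n + 1)
  have hL : 0 ≤ Real.log L := Real.log_nonneg (by linarith)
  have hL0 : 0 < L := by linarith
  have hl : 0 < l := lt_of_lt_of_le (by positivity) h1
  have e : (i : ℝ) + 1 + 1 = i + 2 := by ring
  rw [e]
  refine ⟨?_, ?_, by positivity⟩
  · have : (2 : ℝ) ^ (i + 1) ≤ 2 * l := by rw [pow_succ]; linarith
    have h7 : 0 ≤ Real.log ((i : ℝ) + 2) := Real.log_nonneg (by linarith)
    gcongr
  · have : 1 / 2 * l ≤ (2 : ℝ) ^ (i + 1) := by rw [pow_succ _ (i + 1)] at h2; linarith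
    have h5 : (i : ℝ) + 2 ≤ 2 + L := by linarith
    have h6 : 0 ≤ Real.log ((i : ℝ) + 2) := Real.log_nonneg (by linarith)
    have h7 : 0 ≤ Real.log (2 + L) := Real.log_nonneg (by linarith)
    gcongr

theorem IsSlowRadii.eventually_norm_bounds {p a : ℝ} (hp : 1 < p) (ha : 1 < a) {r : ℕ → ℝ}
    (h : IsSlowRadii p a r) :
    ∀ᶠ n : ℕ in atTop,
      (loglog (n + 1) * Real.log (loglog (n + 1)) ^ a /
          (2 * (1 + Real.logb 2 (n + 1))) ^ (p - 1)) ^ (4 / (p * ((n : ℝ) + 1) ^ 2))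
        ≤ ‖targetPoint r n‖ ∧
      ‖targetPoint r n‖ ≤
        ((2 + loglog (n + 1)) * Real.log (2 + loglog (n + 1)) ^ a /
          ((1 / 2) * (1 + Real.logb 2 (n + 1))) ^ (p - 1)) ^ (1 / (4 * p * ((n : ℝ) + 1) ^ 4)) := by
  have hp0 : 0 < p := by linarith
  filter_upwards [tendsto_blockIndex.eventually (eventually_log_slowBase_bounds hp ha),
    tendsto_blockIndex.eventually h.eventually_eq,
    tendsto_blockIndex.eventually (eventually_ge_atTop 2)] with n hlog hrn hn2
  rw [norm_targetPoint fun j => (h.1 j).1, hrn]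
  have hN : (circleCard (blockIndex n) : ℝ) ≤ 2 * ((n : ℝ) + 1) ^ 2 := by
    exact_mod_cast circleCard_blockIndex_le n
  have hnN : (n : ℝ) + 1 ≤ 2 * circleCard (blockIndex n) := by
    have h1 := lt_blockStart_blockIndex_succ n
    have h2 := blockStart_le_circleCard (blockIndex n)
    rw [blockStart_succ] at h1
    exact_mod_cast (by omega : n + 1 ≤ 2 * circleCard (blockIndex n))
  have hN0 : (0 : ℝ) < circleCard (blockIndex n) := by exact_mod_cast circleCard_pos _
  obtain ⟨i, hi⟩ : ∃ i, blockIndex n = i + 1 := ⟨blockIndex n - 1, by omega⟩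
  obtain ⟨hb1, hb2, hb0⟩ := slowBase_bounds_of_blockIndex_eq hp ha (by omega) hi
  unfold slowRadius
  rw [← hi] at hb1 hb2
  have hB0 : 0 < slowBase p a (blockIndex n) := slowBase_pos p a (by omega)
  have hB1 : slowBase p a (blockIndex n) ≤ 1 := by
    have hκ : 0 < (p - 1) * Real.log 2 := mul_pos (sub_pos.2 hp) (Real.log_pos one_lt_two)
    rw [← Real.log_nonpos_iff hB0.le]
    have : 0 ≤ (p - 1) * Real.log 2 / 2 * (blockIndex n : ℝ) := by positivity
    linarith
  -- As the base is at most `1`, a larger exponent gives a smaller power: `n + 1 ≤ 2 * N` serves the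
  -- lower bound and `N ≤ 2 * (n + 1) ^ 2` the upper one.
  constructor
  · refine (Real.rpow_le_rpow_of_exponent_ge' hb0 (hb1.trans hB1)
      (z := 1 / ((circleCard (blockIndex n) : ℝ) ^ 2 * p)) (by positivity) ?_).trans
      (Real.rpow_le_rpow hb0 hb1 (by positivity))
    rw [div_le_div_iff₀ (by positivity) (by positivity)]
    have : ((n : ℝ) + 1) ^ 2 ≤ (2 * circleCard (blockIndex n)) ^ 2 := by gcongr
    nlinarith
  · refine (Real.rpow_le_rpow_of_exponent_ge' hB0.le hB1
      (z := 1 / (4 * p * ((n : ℝ) + 1) ^ 4)) (by positivity) ?_).trans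
      (Real.rpow_le_rpow hB0.le hb2 (by positivity))
    refine one_div_le_one_div_of_le (by positivity) ?_
    have : (circleCard (blockIndex n) : ℝ) ^ 2 ≤ (2 * ((n : ℝ) + 1) ^ 2) ^ 2 := by gcongr
    nlinarith

end

theorem mainTheorem9 (p : ℝ) (hp : 1 < p) :
    -- arbitrary radii: lacunary products, their zeros and norms, and the zero set
    (∀ r : ℕ → ℝ, (∀ j, 0 < r j ∧ r j < 1) →
      (∀ k, targetPoly r k ∣ lacunaryPoly r k ∧
        ∃ F : EllPA p, (∀ n, F n = (lacunaryPoly r k).coeff n) ∧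
          ‖F‖ ^ p ≤ ∏ j ∈ Finset.range k, (1 + weight p r j)) ∧
      (Summable (weight p r) → IsZeroSet p (targetPoint r))) ∧
    -- explicit radii: existence, and slow convergence to the circle
    (∀ a : ℝ, 1 < a →
      (∃ r : ℕ → ℝ, IsSlowRadii p a r) ∧
      ∀ r : ℕ → ℝ, IsSlowRadii p a r →
        Summable (weight p r) ∧
        IsZeroSet p (targetPoint r) ∧
        Function.Injective (targetPoint r) ∧
        Monotone (fun n => ‖targetPoint r n‖) ∧
        Tendsto (fun n => ‖targetPoint r n‖) atTop (𝓝 1) ∧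
        (∀ᶠ n : ℕ in atTop,
          (loglog (n + 1) * Real.log (loglog (n + 1)) ^ a /
              (2 * (1 + Real.logb 2 (n + 1))) ^ (p - 1)) ^ (4 / (p * ((n : ℝ) + 1) ^ 2))
            ≤ ‖targetPoint r n‖ ∧
          ‖targetPoint r n‖ ≤
            ((2 + loglog (n + 1)) * Real.log (2 + loglog (n + 1)) ^ a /
              ((1 / 2) * (1 + Real.logb 2 (n + 1))) ^ (p - 1)) ^
                (1 / (4 * p * ((n : ℝ) + 1) ^ 4))) ∧
        (∀ c : ℝ, 0 < c → c < 1 →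
          Tendsto (fun n : ℕ => c ^ n / (1 - ‖targetPoint r n‖)) atTop (𝓝 0)) ∧
        ¬ CoveredByNewmanShapiro (targetPoint r)) := by
  refine ⟨fun r hr => ⟨fun k => ⟨targetPoly_dvd_lacunaryPoly r k, exists_lp_lacunaryPoly hp hr k⟩,
    isZeroSet_targetPoint hp hr⟩, fun a ha => ⟨exists_isSlowRadii hp ha, fun r h => ?_⟩⟩
  have hpos (j : ℕ) : 0 < r j := (h.1 j).1
  have hs := h.summable_weight hp ha
  refine ⟨hs, isZeroSet_targetPoint hp h.1 hs, injective_targetPoint hpos h.2.1.injective,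
    monotone_norm_targetPoint hpos h.2.1.monotone, ?_, h.eventually_norm_bounds hp ha,
    fun c hc hc1 => tendsto_pow_div_one_sub_norm hp ha h hc hc1,
    not_coveredByNewmanShapiro hpos h.2.1.injective⟩
  simp only [norm_targetPoint hpos]
  exact ((tendsto_slowRadius hp ha).congr' h.eventually_eq.symm).comp tendsto_blockIndex
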